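/- Let $\mathcal D\subset\mathbb R^2$ be a bounded open set with Lipschitz boundary, let $\Omega$ be an open set with $\overline\Omega\subset\mathcal D$, let $k_I,k_E>0$ and $k_\Omega=k_I\chi_\Omega+k_E(1-\chi_\Omega)$. Put $$a_\Omega(u,v)=\int_{\mathcal D}\big(k_\Omega\nabla u\cdot\nabla v+uv\big)\,dx,\qquad |||v|||=a_\Omega(v,v)^{1/2},$$ and $H(\operatorname{div})=\{\sigma\in L^2(\mathcal D;\mathbb R^2):\nabla\cdot\sigma\in L^2(\mathcal D)\}$. For $\sigma\in H(\operatorname{div})$ and $g\in L^2(\partial\mathcal D)$, the condition $\sigma\cdot n=g$ on $\partial\mathcal D$ means that $\int_{\mathcal D}(\sigma\cdot\nabla v+(\nabla\cdot\sigma)v)\,dx=\int_{\partial\mathcal D}g\,v\,ds$ for all $v\in H^1(\mathcal D)$. A boundary datum $U_D\in H^{1/2}(\partial\mathcal D)$ is given by a lifting, also denoted $U_D\in H^1(\mathcal D)$, and for $v\in H^1(\mathcal D)$ the condition $v=U_D$ on $\partial\mathcal D$ means $v-U_D\in H^1_0(\mathcal D)$. For $\theta\in W^{1,\infty}(\mathcal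 D;\mathbb R^2)$ let $M(\theta)=\nabla\theta+\nabla\theta^T-(\nabla\cdot\theta)\operatorname{Id}$ and $$\langle G(\Omega,u),\theta\rangle=\frac12\int_{\mathcal D}\big(k_\Omega M(\theta)\nabla u\cdot\nabla u-(\nabla\cdot\theta)u^2\big)\,dx .$$ Denote by $\frac{\partial G}{\partial u}(\Omega,u)[\theta,\delta]$ the derivative of $\langle G(\Omega,\cdot),\theta\rangle$ at $u$ in the direction $\delta$. Then the following hold. 1. (State problems.) Let $g\in L^2(\partial\mathcal D)$ and let $u_N\in H^1(\mathcal D)$ satisfy $a_\Omega(u_N,v)=\int_{\partial\mathcal D}g\,v\,ds$ for all $v\in H^1(\mathcal D)$. Let $U_D\in H^{1/2}(\partial\mathcal D)$ and let $u_D\in H^1(\mathcal D)$ satisfy $u_D=U_D$ on $\partial\mathcal D$ and $a_\Omega(u_D,v)=0$ for all $v\in H^1_0(\mathcal D)$. Then, for $i=N,D$, for all $u_i^h\in H^1(\mathcal D)$, with $u_D^h=U_D$ on $\partial\mathcal D$ if $i=D$, and for all $\sigma_i^h\in H(\operatorname{div})$, with $\sigma_N^h\cdot n=g$ on $\partial\mathcal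 D$ if $i=N$, $$|||u_i-u_i^h|||^2\le\int_{\mathcal D}\Big(k_\Omega^{-1}|\sigma_i^h-k_\Omega\nabla u_i^h|^2+|\nabla\cdot\sigma_i^h-u_i^h|^2\Big)\,dx .$$ 2. (Adjoint problems.) Let $V_N=H^1(\mathcal D)$ and $V_D=H^1_0(\mathcal D)$. Let $i\in\{N,D\}$, $\theta^h\in W^{1,\infty}(\mathcal D;\mathbb R^2)$ and $u_i^h\in H^1(\mathcal D)$, and let $r_i\in V_i$ satisfy $a_\Omega(\delta,r_i)=\frac{\partial G}{\partial u}(\Omega,u_i^h)[\theta^h,\delta]$ for all $\delta\in V_i$. Then for all $r_i^h\in V_i$ and all $\xi_i^h\in H(\operatorname{div})$, with $\xi_N^h\cdot n=0$ on $\partial\mathcal D$ if $i=N$, $$|||r_i-r_i^h|||^2\le\int_{\mathcal D}\Big(k_\Omega^{-1}|\xi_i^h+k_\Omega M(\theta^h)\nabla u_i^h-k_\Omega\nabla r_i^h|^2+|\nabla\cdot\xi_i^h-(\nabla\cdot\theta^h)u_i^h-r_i^h|^2\Big)\,dx .$$ In particular, the bounds apply to conforming Lagrangian finite element approximations $u_i^h,r_i^h$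 and to Raviart–Thomas fluxes $\sigma_i^h,\xi_i^h$ satisfying the stated boundary conditions. -/

import Mathlib

open MeasureTheory Topology
open scoped ENNReal NNReal ContDiff

noncomputable section

namespace EIT

/-- The Euclidean plane. -/
abbrev Plane : Type := EuclideanSpace ℝ (Fin 2)

/-! ### Domains -/

/-- Bounded open set whose boundary is locally, after a linear isometry of the plane, the graph of
a Lipschitz function, with the set lying strictly above the graph. -/
def IsBoundedLipschitz (D : Set Plane) : Prop :=
  IsOpen D ∧ Bornology.IsBounded D ∧
    ∀ x ∈ frontier D, ∃ (R : Plane ≃ₗᵢ[ℝ] Plane) (K : ℝ≥0) (γ : ℝ → ℝ), LipschitzWith K γ ∧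
      ∀ᶠ y in 𝓝 x, (y ∈ D ↔ γ (R y 0) < R y 1)

/-- The arc-length measure on `∂D` (one-dimensional Hausdorff measure). -/
def bdryMeasure (D : Set Plane) : Measure Plane := (μH[1] : Measure Plane).restrict (frontier D)

/-! ### Sobolev spaces -/

/-- `φ ∈ C_c^∞(D)`. -/
def IsTestFun (D : Set Plane) (φ : Plane → ℝ) : Prop :=
  ContDiff ℝ ∞ φ ∧ HasCompactSupport φ ∧ tsupport φ ⊆ D

/-- `G ∈ L¹_loc(D; ℝ²)` is a weak gradient of `u ∈ L¹_loc(D)`. -/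
def HasWeakGrad (D : Set Plane) (u : Plane → ℝ) (G : Plane → Plane) : Prop :=
  LocallyIntegrableOn u D ∧ LocallyIntegrableOn G D ∧
    ∀ φ : Plane → ℝ, IsTestFun D φ →
      ∫ x in D, u x • gradient φ x = -∫ x in D, φ x • G x

open Classical in
/-- The weak gradient (unique almost everywhere in `D` when `D` is open); zero if there is none. -/
def weakGrad (D : Set Plane) (u : Plane → ℝ) : Plane → Plane :=
  if h : ∃ G, HasWeakGrad D u G then h.choose else 0

/-- `u ∈ W^{1,p}(D)`. -/
def MemW1 (p : ℝ≥0∞) (D : Set Plane) (u : Plane → ℝ) : Prop :=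
  MemLp u p (volume.restrict D) ∧
    ∃ G, HasWeakGrad D u G ∧ MemLp G p (volume.restrict D)

/-- `u ∈ H¹(D)`. -/
def MemH1 (D : Set Plane) (u : Plane → ℝ) : Prop := MemW1 2 D u

/-- `u ∈ H¹₀(D)`, the closure of `C_c^∞(D)` in `H¹(D)`. -/
def MemH10 (D : Set Plane) (u : Plane → ℝ) : Prop :=
  MemH1 D u ∧ ∀ ε : ℝ≥0∞, 0 < ε → ∃ φ : Plane → ℝ, IsTestFun D φ ∧
    eLpNorm (fun x => u x - φ x) 2 (volume.restrict D) < ε ∧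
    eLpNorm (fun x => weakGrad D u x - gradient φ x) 2 (volume.restrict D) < ε

/-- `u = w` on `∂D` for `u, w ∈ H¹(D)`: the difference lies in `H¹₀(D)`. -/
def EqOnBdry (D : Set Plane) (u w : Plane → ℝ) : Prop := MemH10 D (fun x => u x - w x)

/-- `τ ∈ L²(∂D)` is the trace of `v ∈ H¹(D)`: some functions smooth up to the boundary converge to
`v` in `H¹(D)` while their restrictions to `∂D` converge to `τ` in `L²(∂D)`. -/
def HasTrace (D : Set Plane) (v τ : Plane → ℝ) : Prop :=
  MemLp τ 2 (bdryMeasure D) ∧ ∀ ε : ℝ≥0∞, 0 < ε → ∃ φ : Plane → ℝ, ContDiff ℝ ∞ φ ∧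
    eLpNorm (fun x => v x - φ x) 2 (volume.restrict D) < ε ∧
    eLpNorm (fun x => weakGrad D v x - gradient φ x) 2 (volume.restrict D) < ε ∧
    eLpNorm (fun x => τ x - φ x) 2 (bdryMeasure D) < ε

open Classical in
/-- The trace of `v` on `∂D`. On a bounded Lipschitz domain every `v ∈ H¹(D)` has a trace, unique
up to sets of arc length zero. -/
def trace (D : Set Plane) (v : Plane → ℝ) : Plane → ℝ :=
  if h : ∃ τ, HasTrace D v τ then h.choose else 0

/-! ### The space `H(div)` -/

/-- `f ∈ L¹_loc(D)` is a weak divergence of `σ ∈ L¹_loc(D; ℝ²)`. -/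
def HasWeakDiv (D : Set Plane) (σ : Plane → Plane) (f : Plane → ℝ) : Prop :=
  LocallyIntegrableOn σ D ∧ LocallyIntegrableOn f D ∧
    ∀ φ : Plane → ℝ, IsTestFun D φ →
      ∫ x in D, inner ℝ (σ x) (gradient φ x) = -∫ x in D, f x * φ x

open Classical in
/-- The weak divergence (unique almost everywhere in `D` when `D` is open); zero if there is
none. -/
def weakDiv (D : Set Plane) (σ : Plane → Plane) : Plane → ℝ :=
  if h : ∃ f, HasWeakDiv D σ f then h.choose else 0

/-- `σ ∈ H(div)`: both `σ` and its weak divergence are square integrable on `D`. -/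
def MemHdiv (D : Set Plane) (σ : Plane → Plane) : Prop :=
  MemLp σ 2 (volume.restrict D) ∧
    ∃ f, HasWeakDiv D σ f ∧ MemLp f 2 (volume.restrict D)

/-- `σ · n = g` on `∂D` for `σ ∈ H(div)`, `g ∈ L²(∂D)`: the normal trace of `σ`, defined by Green's
formula as a functional on `H¹(D)`, is integration against `g`. -/
def HasNormalTrace (D : Set Plane) (σ : Plane → Plane) (g : Plane → ℝ) : Prop :=
  ∀ v : Plane → ℝ, MemH1 D v →
    ∫ x in D, (inner ℝ (σ x) (weakGrad D v x) + weakDiv D σ x * v x) =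
      ∫ x, g x * trace D v x ∂(bdryMeasure D)

/-! ### The forms of the EIT problems -/

open Classical in
/-- The conductivity `k_Ω = k_I χ_Ω + k_E (1 - χ_Ω)`. -/
def cond (Ω : Set Plane) (kI kE : ℝ) (x : Plane) : ℝ := if x ∈ Ω then kI else kE

/-- `a(u, v) = ∫_D (k ∇u · ∇v + u v) dx`. -/
def aForm (D : Set Plane) (k : Plane → ℝ) (u v : Plane → ℝ) : ℝ :=
  ∫ x in D, (k x * inner ℝ (weakGrad D u x) (weakGrad D v x) + u x * v x)

/-- The energy norm induced by `a`. -/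
def energyNorm (D : Set Plane) (k : Plane → ℝ) (v : Plane → ℝ) : ℝ :=
  Real.sqrt (aForm D k v v)

/-- `F_N(v) = ∫_{∂D} g v ds`. -/
def FN (D : Set Plane) (g v : Plane → ℝ) : ℝ := ∫ x, g x * trace D v x ∂(bdryMeasure D)

/-- Variational Neumann state problem. -/
def IsNeumannState (D : Set Plane) (k : Plane → ℝ) (g u : Plane → ℝ) : Prop :=
  MemH1 D u ∧ ∀ v, MemH1 D v → aForm D k u v = FN D g v

/-- Variational Dirichlet state problem; the boundary datum is given by a lifting `U ∈ H¹(D)`. -/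
def IsDirichletState (D : Set Plane) (k : Plane → ℝ) (U u : Plane → ℝ) : Prop :=
  MemH1 D u ∧ EqOnBdry D u U ∧ ∀ v, MemH10 D v → aForm D k u v = 0

/-- `θ ∈ W^{1,∞}(D; ℝ²)`. -/
def MemW1inf (D : Set Plane) (θ : Plane → Plane) : Prop :=
  ∀ i : Fin 2, MemW1 ∞ D (fun x => θ x i)

/-- The Jacobian matrix `∇θ`. -/
def jac (D : Set Plane) (θ : Plane → Plane) (x : Plane) : Matrix (Fin 2) (Fin 2) ℝ :=
  Matrix.of fun i j => weakGrad D (fun y => θ y i) x j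

/-- `∇ · θ`. -/
def divField (D : Set Plane) (θ : Plane → Plane) (x : Plane) : ℝ := (jac D θ x).trace

/-- `M(θ) = ∇θ + ∇θᵀ - (∇ · θ) Id`. -/
def Mmat (D : Set Plane) (θ : Plane → Plane) (x : Plane) : Matrix (Fin 2) (Fin 2) ℝ :=
  jac D θ x + (jac D θ x).transpose - divField D θ x • (1 : Matrix (Fin 2) (Fin 2) ℝ)

/-- The vector field `M(θ) ∇u`. -/
def MGrad (D : Set Plane) (θ : Plane → Plane) (u : Plane → ℝ) (x : Plane) : Plane :=
  WithLp.toLp 2 ((Mmat D θ x).mulVec (WithLp.ofLp (weakGrad D u x)))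

/-- `⟨G(Ω, u), θ⟩ = ½ ∫_D (k M(θ) ∇u · ∇u - (∇ · θ) u²) dx`. -/
def shapeG (D : Set Plane) (k : Plane → ℝ) (θ : Plane → Plane) (u : Plane → ℝ) : ℝ :=
  (1 / 2 : ℝ) * ∫ x in D,
    (k x * inner ℝ (MGrad D θ u x) (weakGrad D u x) - divField D θ x * u x ^ 2)

/-- `H(δ) = ∂G/∂u(Ω, u)[θ, δ]`, the derivative of `⟨G(Ω, ·), θ⟩` at `u` in the direction `δ`. -/
def HForm (D : Set Plane) (k : Plane → ℝ) (θ : Plane → Plane) (u δ : Plane → ℝ) : ℝ :=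
  deriv (fun t : ℝ => shapeG D k θ (fun x => u x + t * δ x)) 0

/-- Adjoint problem on `H¹(D)` (Neumann case) with data `θ` and `uh`. -/
def IsNeumannAdjoint (D : Set Plane) (k : Plane → ℝ) (θ : Plane → Plane)
    (uh r : Plane → ℝ) : Prop :=
  MemH1 D r ∧ ∀ δ, MemH1 D δ → aForm D k δ r = HForm D k θ uh δ

/-- Adjoint problem on `H¹₀(D)` (Dirichlet case) with data `θ` and `uh`. -/
def IsDirichletAdjoint (D : Set Plane) (k : Plane → ℝ) (θ : Plane → Plane)
    (uh r : Plane → ℝ) : Prop :=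
  MemH10 D r ∧ ∀ δ, MemH10 D δ → aForm D k δ r = HForm D k θ uh δ

/-! ### The estimators -/

/-- `∫_D (k⁻¹ |σ - k ∇uh|² + |∇ · σ - uh|²) dx`. -/
def stateBound (D : Set Plane) (k : Plane → ℝ) (uh : Plane → ℝ) (σ : Plane → Plane) : ℝ :=
  ∫ x in D, ((k x)⁻¹ * ‖σ x - k x • weakGrad D uh x‖ ^ 2 + |weakDiv D σ x - uh x| ^ 2)

/-- `∫_D (k⁻¹ |ξ + k M(θ) ∇uh - k ∇rh|² + |∇ · ξ - (∇ · θ) uh - rh|²) dx`. -/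
def adjBound (D : Set Plane) (k : Plane → ℝ) (θ : Plane → Plane) (uh rh : Plane → ℝ)
    (ξ : Plane → Plane) : ℝ :=
  ∫ x in D, ((k x)⁻¹ * ‖ξ x + k x • MGrad D θ uh x - k x • weakGrad D rh x‖ ^ 2 +
    |weakDiv D ξ x - divField D θ x * uh x - rh x| ^ 2)

end EIT

end

/-!
The bounds are of Prager–Synge type. Let `w` be the error (`u - uh` or `r - rh`). The variational
problem gives `a(w, w) = load(w) - a(b, w)`, with `b` the approximate solution, and Green's formula
for the flux writes the boundary part of the load (the integral of `g w` for the Neumann state, zero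
in the other cases) as `∫ σ · ∇w + (∇ · σ) w`. Hence `a(w, w) = ∫ p · ∇w + q w`, where `p` and `q` are the residuals in
the estimator, and Young's inequality with weight `k` bounds this by half the estimator plus
`½ a(w, w)` (`energyNorm_sq_le_of_residual`, `energyNorm_sq_le_of_flux`).

Three facts make this rigorous. Weak gradients and divergences are unique almost everywhere, so the
chosen representatives are square integrable and linear in the function
(`weakGrad_add_mul_ae_eq`, `MemHdiv.memLp_weakDiv`). Green's formula against `H¹₀` follows from the
definition of the weak divergence by density of test functions (`MemHdiv.green_of_memH10`).
Finally, `t ↦ ⟨G(Ω, u + t δ), θ⟩` is a quadratic polynomial, and since `M(θ)` is symmetric its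
linear coefficient is `∫ k M(θ)∇u · ∇δ - (∇ · θ) u δ` (`HForm_eq`).
-/

namespace EIT

variable {D : Set Plane}

/-! ### Products of square integrable functions -/

lemma integrable_inner_of_memLp {α : Type*} [MeasurableSpace α] {μ : Measure α} {f g : α → Plane}
    (hf : MemLp f 2 μ) (hg : MemLp g 2 μ) : Integrable (fun x => inner ℝ (f x) (g x)) μ :=
  memLp_one_iff_integrable.1 ((innerSL ℝ (E := Plane)).memLp_of_bilin 1 hf hg)

/-- Cauchy–Schwarz for the `L²` pairing, in terms of `eLpNorm`. -/
lemma abs_integral_inner_le {α E : Type*} [MeasurableSpace α] {μ : Measure α}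
    [NormedAddCommGroup E] [InnerProductSpace ℝ E] {f g : α → E}
    (hf : MemLp f 2 μ) (hg : MemLp g 2 μ) :
    |∫ x, inner ℝ (f x) (g x) ∂μ| ≤ (eLpNorm f 2 μ).toReal * (eLpNorm g 2 μ).toReal := by
  have h := abs_real_inner_le_norm (hf.toLp f) (hg.toLp g)
  rw [Lp.norm_toLp, Lp.norm_toLp, L2.inner_def] at h
  refine le_of_eq_of_le ?_ h
  congr 1
  refine integral_congr_ae ?_
  filter_upwards [hf.coeFn_toLp, hg.coeFn_toLp] with x hx hx'
  rw [hx, hx']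

/-! ### Pairing with test functions -/

lemma integrableOn_pairing {E F H : Type*} [NormedAddCommGroup E] [NormedSpace ℝ E]
    [NormedAddCommGroup F] [NormedSpace ℝ F] [NormedAddCommGroup H] [NormedSpace ℝ H]
    [SecondCountableTopology F]
    (B : E →L[ℝ] F →L[ℝ] H) {f : Plane → E} {g : Plane → F} (hf : LocallyIntegrableOn f D)
    (hg : Continuous g) (hgc : HasCompactSupport g) (hgD : tsupport g ⊆ D) :
    IntegrableOn (fun x => B (f x) (g x)) D := by
  have hfK : IntegrableOn f (tsupport g) := hf.integrableOn_compact_subset hgD hgc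
  obtain ⟨C, hC⟩ := hgc.exists_bound_of_continuous hg
  have h : IntegrableOn (fun x => B (f x) (g x)) (tsupport g) :=
    B.integrable_of_bilin_of_bdd_right C hfK hg.aestronglyMeasurable
      (Filter.Eventually.of_forall hC)
  rw [integrableOn_iff_integrable_of_support_subset] at h
  · exact h.integrableOn
  · intro x hx
    by_contra hx'
    exact hx (by simp [image_eq_zero_of_notMem_tsupport hx'])

lemma gradient_sub_eq {φ ψ : Plane → ℝ} {x : Plane} (hφ : DifferentiableAt ℝ φ x)
    (hψ : DifferentiableAt ℝ ψ x) :
    gradient (fun y => φ y - ψ y) x = gradient φ x - gradient ψ x := by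
  simp only [gradient, fderiv_fun_sub hφ hψ, map_sub]

lemma IsTestFun.differentiable {φ : Plane → ℝ} (h : IsTestFun D φ) : Differentiable ℝ φ :=
  h.1.differentiable (by simp)

lemma IsTestFun.continuous_gradient {φ : Plane → ℝ} (h : IsTestFun D φ) :
    Continuous (gradient φ) :=
  (InnerProductSpace.toDual ℝ Plane).symm.continuous.comp (h.1.continuous_fderiv (by simp))

lemma tsupport_gradient_subset (φ : Plane → ℝ) : tsupport (gradient φ) ⊆ tsupport φ := by
  refine (closure_mono fun x hx => ?_).trans (tsupport_fderiv_subset ℝ (f := φ))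
  intro h0
  exact hx (by simp [gradient, h0])

lemma IsTestFun.hasCompactSupport_gradient {φ : Plane → ℝ} (h : IsTestFun D φ) :
    HasCompactSupport (gradient φ) :=
  h.2.1.of_isClosed_subset (isClosed_tsupport _) (tsupport_gradient_subset φ)

lemma IsTestFun.sub {φ ψ : Plane → ℝ} (hφ : IsTestFun D φ) (hψ : IsTestFun D ψ) :
    IsTestFun D (fun x => φ x - ψ x) :=
  ⟨hφ.1.sub hψ.1, hφ.2.1.sub hψ.2.1,
    (tsupport_sub φ ψ).trans (Set.union_subset hφ.2.2 hψ.2.2)⟩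

lemma IsTestFun.memLp {φ : Plane → ℝ} (h : IsTestFun D φ) (p : ℝ≥0∞) :
    MemLp φ p (volume.restrict D) :=
  (h.1.continuous.memLp_of_hasCompactSupport h.2.1).restrict D

lemma IsTestFun.memLp_gradient {φ : Plane → ℝ} (h : IsTestFun D φ) (p : ℝ≥0∞) :
    MemLp (gradient φ) p (volume.restrict D) :=
  (h.continuous_gradient.memLp_of_hasCompactSupport h.hasCompactSupport_gradient).restrict D

lemma IsTestFun.integrable_smul {E : Type*} [NormedAddCommGroup E] [NormedSpace ℝ E]
    {φ : Plane → ℝ} (h : IsTestFun D φ) {G : Plane → E} (hG : LocallyIntegrableOn G D) :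
    IntegrableOn (fun x => φ x • G x) D :=
  integrableOn_pairing (ContinuousLinearMap.lsmul ℝ ℝ (E := E)).flip hG h.1.continuous h.2.1 h.2.2

lemma IsTestFun.integrable_smul_gradient {φ : Plane → ℝ} (h : IsTestFun D φ) {u : Plane → ℝ}
    (hu : LocallyIntegrableOn u D) : IntegrableOn (fun x => u x • gradient φ x) D :=
  integrableOn_pairing (ContinuousLinearMap.lsmul ℝ ℝ (E := Plane)) hu h.continuous_gradient
    h.hasCompactSupport_gradient ((tsupport_gradient_subset φ).trans h.2.2)

/-- The fundamental lemma of the calculus of variations, on an open set. -/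
lemma ae_eq_of_integral_test_eq {E : Type*} [NormedAddCommGroup E] [NormedSpace ℝ E]
    [CompleteSpace E] (hD : IsOpen D) {F G : Plane → E} (hF : LocallyIntegrableOn F D)
    (hG : LocallyIntegrableOn G D)
    (h : ∀ φ, IsTestFun D φ → ∫ x in D, φ x • F x = ∫ x in D, φ x • G x) :
    F =ᵐ[volume.restrict D] G := by
  have h0 : ∀ᵐ x, x ∈ D → (F - G) x = 0 := by
    refine hD.ae_eq_zero_of_integral_contDiff_smul_eq_zero (hF.sub hG) fun φ h1 h2 h3 => ?_
    have hφ : IsTestFun D φ := ⟨h1, h2, h3⟩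
    rw [← setIntegral_eq_integral_of_forall_compl_eq_zero (s := D)]
    · simp only [Pi.sub_apply, smul_sub]
      rw [integral_sub (hφ.integrable_smul hF) (hφ.integrable_smul hG), h φ hφ, sub_self]
    · intro x hx
      rw [image_eq_zero_of_notMem_tsupport fun h' => hx (h3 h'), zero_smul]
  filter_upwards [(ae_restrict_iff' hD.measurableSet).2 h0] with x hx using sub_eq_zero.1 hx

/-! ### Weak gradients -/

lemma HasWeakGrad.ae_eq (hD : IsOpen D) {u : Plane → ℝ} {F G : Plane → Plane}
    (hF : HasWeakGrad D u F) (hG : HasWeakGrad D u G) : F =ᵐ[volume.restrict D] G :=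
  ae_eq_of_integral_test_eq hD hF.2.1 hG.2.1 fun φ hφ =>
    neg_injective ((hF.2.2 φ hφ).symm.trans (hG.2.2 φ hφ))

lemma HasWeakGrad.weakGrad {u : Plane → ℝ} {G : Plane → Plane} (h : HasWeakGrad D u G) :
    HasWeakGrad D u (weakGrad D u) := by
  have h' : ∃ G, HasWeakGrad D u G := ⟨G, h⟩
  rw [EIT.weakGrad, dif_pos h']
  exact h'.choose_spec

lemma HasWeakGrad.add_mul {u v : Plane → ℝ} {F G : Plane → Plane} (hu : HasWeakGrad D u F)
    (hv : HasWeakGrad D v G) (t : ℝ) :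
    HasWeakGrad D (fun x => u x + t * v x) (fun x => F x + t • G x) := by
  refine ⟨hu.1.add (hv.1.smul t), hu.2.1.add (hv.2.1.smul t), fun φ hφ => ?_⟩
  have e1 : ∀ x, (u x + t * v x) • gradient φ x
      = u x • gradient φ x + t • (v x • gradient φ x) := fun x => by module
  have e2 : ∀ x, φ x • (F x + t • G x) = φ x • F x + t • (φ x • G x) := fun x => by module
  have i1 : IntegrableOn (fun x => t • (v x • gradient φ x)) D :=
    (hφ.integrable_smul_gradient hv.1).smul t
  have i2 : IntegrableOn (fun x => t • (φ x • G x)) D := (hφ.integrable_smul hv.2.1).smul t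
  simp only [e1, e2]
  rw [integral_add (hφ.integrable_smul_gradient hu.1) i1,
    integral_add (hφ.integrable_smul hu.2.1) i2, integral_smul, integral_smul,
    hu.2.2 φ hφ, hv.2.2 φ hφ]
  module

lemma MemW1.hasWeakGrad {p : ℝ≥0∞} {u : Plane → ℝ} (hu : MemW1 p D u) :
    HasWeakGrad D u (weakGrad D u) :=
  let ⟨_, _, hG, _⟩ := hu
  hG.weakGrad

lemma MemW1.memLp_weakGrad (hD : IsOpen D) {p : ℝ≥0∞} {u : Plane → ℝ} (hu : MemW1 p D u) :
    MemLp (weakGrad D u) p (volume.restrict D) :=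
  let ⟨_, _, hG, hGp⟩ := hu
  (memLp_congr_ae (hG.weakGrad.ae_eq hD hG)).2 hGp

lemma MemW1.add_mul (hD : IsOpen D) {p : ℝ≥0∞} {u v : Plane → ℝ} (hu : MemW1 p D u)
    (hv : MemW1 p D v) (t : ℝ) : MemW1 p D (fun x => u x + t * v x) :=
  ⟨hu.1.add (hv.1.const_mul t), _, hu.hasWeakGrad.add_mul hv.hasWeakGrad t,
    (hu.memLp_weakGrad hD).add ((hv.memLp_weakGrad hD).const_smul t)⟩

lemma weakGrad_add_mul_ae_eq (hD : IsOpen D) {p : ℝ≥0∞} {u v : Plane → ℝ} (hu : MemW1 p D u)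
    (hv : MemW1 p D v) (t : ℝ) :
    ∀ᵐ x ∂volume.restrict D,
      weakGrad D (fun x => u x + t * v x) x = weakGrad D u x + t • weakGrad D v x :=
  let h := hu.hasWeakGrad.add_mul hv.hasWeakGrad t
  h.weakGrad.ae_eq hD h

lemma MemW1.sub (hD : IsOpen D) {p : ℝ≥0∞} {u v : Plane → ℝ} (hu : MemW1 p D u)
    (hv : MemW1 p D v) : MemW1 p D (fun x => u x - v x) := by
  simpa [sub_eq_add_neg] using hu.add_mul hD hv (-1)

lemma weakGrad_sub_ae_eq (hD : IsOpen D) {p : ℝ≥0∞} {u v : Plane → ℝ} (hu : MemW1 p D u)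
    (hv : MemW1 p D v) :
    ∀ᵐ x ∂volume.restrict D,
      weakGrad D (fun x => u x - v x) x = weakGrad D u x - weakGrad D v x := by
  simpa [sub_eq_add_neg] using weakGrad_add_mul_ae_eq hD hu hv (-1)

lemma MemH10.sub (hD : IsOpen D) {u v : Plane → ℝ} (hu : MemH10 D u) (hv : MemH10 D v) :
    MemH10 D (fun x => u x - v x) := by
  refine ⟨hu.1.sub hD hv.1, fun ε hε => ?_⟩
  have hε2 : 0 < ε / 2 := ENNReal.half_pos hε.ne'
  obtain ⟨φ, hφ, hφ1, hφ2⟩ := hu.2 _ hε2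
  obtain ⟨ψ, hψ, hψ1, hψ2⟩ := hv.2 _ hε2
  refine ⟨_, hφ.sub hψ, ?_, ?_⟩
  · have e : (fun x => u x - v x - (φ x - ψ x))
        = (fun x => u x - φ x) - (fun x => v x - ψ x) := by
      funext x; simp only [Pi.sub_apply]; ring
    rw [e, ← ENNReal.add_halves ε]
    exact (eLpNorm_sub_le (hu.1.1.sub (hφ.memLp 2)).1 (hv.1.1.sub (hψ.memLp 2)).1
      (by norm_num)).trans_lt (ENNReal.add_lt_add hφ1 hψ1)
  · have e : (fun x => weakGrad D (fun x => u x - v x) x - gradient (fun x => φ x - ψ x) x)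
        =ᵐ[volume.restrict D] (fun x => weakGrad D u x - gradient φ x)
          - (fun x => weakGrad D v x - gradient ψ x) := by
      filter_upwards [weakGrad_sub_ae_eq hD hu.1 hv.1] with x hx
      rw [hx, gradient_sub_eq (hφ.differentiable x) (hψ.differentiable x)]
      simp only [Pi.sub_apply]; abel
    rw [eLpNorm_congr_ae e, ← ENNReal.add_halves ε]
    exact (eLpNorm_sub_le ((hu.1.memLp_weakGrad hD).sub (hφ.memLp_gradient 2)).1
      ((hv.1.memLp_weakGrad hD).sub (hψ.memLp_gradient 2)).1
      (by norm_num)).trans_lt (ENNReal.add_lt_add hφ2 hψ2)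

/-! ### Weak divergences and Green's formula -/

lemma MemHdiv.hasWeakDiv {σ : Plane → Plane} (hσ : MemHdiv D σ) :
    HasWeakDiv D σ (weakDiv D σ) := by
  have h' : ∃ f, HasWeakDiv D σ f := let ⟨_, f, hf, _⟩ := hσ; ⟨f, hf⟩
  rw [weakDiv, dif_pos h']
  exact h'.choose_spec

lemma MemHdiv.memLp_weakDiv (hD : IsOpen D) {σ : Plane → Plane} (hσ : MemHdiv D σ) :
    MemLp (weakDiv D σ) 2 (volume.restrict D) := by
  have h := hσ.hasWeakDiv
  obtain ⟨-, f, hf, hf2⟩ := hσ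
  refine (memLp_congr_ae (ae_eq_of_integral_test_eq hD h.2.1 hf.2.1 fun φ hφ => ?_)).2 hf2
  simpa only [smul_eq_mul, mul_comm] using
    neg_injective ((h.2.2 φ hφ).symm.trans (hf.2.2 φ hφ))

lemma MemHdiv.integrable_green (hD : IsOpen D) {σ : Plane → Plane} (hσ : MemHdiv D σ)
    {v : Plane → ℝ} (hv : MemH1 D v) :
    IntegrableOn (fun x => inner ℝ (σ x) (weakGrad D v x) + weakDiv D σ x * v x) D :=
  (integrable_inner_of_memLp hσ.1 (hv.memLp_weakGrad hD)).add
    ((hσ.memLp_weakDiv hD).integrable_mul hv.1)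

/-- Green's formula against `H¹₀(D)`. It holds for test functions by definition of the weak
divergence, and both pairings are continuous for the `H¹` norm. -/
lemma MemHdiv.green_of_memH10 (hD : IsOpen D) {σ : Plane → Plane} (hσ : MemHdiv D σ)
    {v : Plane → ℝ} (hv : MemH10 D v) :
    ∫ x in D, (inner ℝ (σ x) (weakGrad D v x) + weakDiv D σ x * v x) = 0 := by
  have hf := hσ.memLp_weakDiv hD
  have hG := hv.1.memLp_weakGrad hD
  set μ := volume.restrict D
  set C := (eLpNorm σ 2 μ).toReal + (eLpNorm (weakDiv D σ) 2 μ).toReal with hC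
  have hC0 : 0 ≤ C := by positivity
  have key : ∀ ε : ℝ, 0 < ε →
      |∫ x, (inner ℝ (σ x) (weakGrad D v x) + weakDiv D σ x * v x) ∂μ| ≤ C * ε := by
    intro ε hε
    obtain ⟨φ, hφ, h1, h2⟩ := hv.2 (ENNReal.ofReal ε) (by simpa using hε)
    have hd1 := hv.1.1.sub (hφ.memLp 2)
    have hd2 := hG.sub (hφ.memLp_gradient 2)
    have e1 : ∫ x, inner ℝ (σ x) (weakGrad D v x - gradient φ x) ∂μ
        = ∫ x, inner ℝ (σ x) (weakGrad D v x) ∂μ - ∫ x, inner ℝ (σ x) (gradient φ x) ∂μ := by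
      simp only [inner_sub_right]
      exact integral_sub (integrable_inner_of_memLp hσ.1 hG)
        (integrable_inner_of_memLp hσ.1 (hφ.memLp_gradient 2))
    have e2 : ∫ x, inner ℝ (weakDiv D σ x) (v x - φ x) ∂μ
        = ∫ x, weakDiv D σ x * v x ∂μ - ∫ x, weakDiv D σ x * φ x ∂μ := by
      simp only [RCLike.inner_apply, conj_trivial, sub_mul]
      rw [integral_sub]
      · simp only [mul_comm]
      · exact hv.1.1.integrable_mul hf
      · exact (hφ.memLp 2).integrable_mul hf
    have e3 := hσ.hasWeakDiv.2.2 φ hφ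
    have e4 : ∫ x, (inner ℝ (σ x) (weakGrad D v x) + weakDiv D σ x * v x) ∂μ
        = ∫ x, inner ℝ (σ x) (weakGrad D v x - gradient φ x) ∂μ
          + ∫ x, inner ℝ (weakDiv D σ x) (v x - φ x) ∂μ := by
      have i : Integrable (fun x => weakDiv D σ x * v x) μ := hf.integrable_mul hv.1.1
      rw [e1, e2, integral_add (integrable_inner_of_memLp hσ.1 hG) i]
      change ∫ x in D, _ = _ at e3
      rw [e3]
      ring
    have b1 : (eLpNorm (fun x => v x - φ x) 2 μ).toReal ≤ ε :=
      ENNReal.toReal_le_of_le_ofReal hε.le h1.le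
    have b2 : (eLpNorm (fun x => weakGrad D v x - gradient φ x) 2 μ).toReal ≤ ε :=
      ENNReal.toReal_le_of_le_ofReal hε.le h2.le
    rw [e4, hC, add_mul]
    refine (abs_add_le _ _).trans (add_le_add ?_ ?_)
    · exact (abs_integral_inner_le hσ.1 hd2).trans (by gcongr; exact b2)
    · exact (abs_integral_inner_le hf hd1).trans (by gcongr; exact b1)
  refine abs_eq_zero.1 (le_antisymm (le_of_forall_pos_le_add fun ε hε => ?_) (abs_nonneg _))
  refine (key (ε / (C + 1)) (by positivity)).trans ?_
  rw [zero_add, mul_div_assoc', div_le_iff₀ (by positivity)]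
  nlinarith

/-! ### The energy form -/

lemma cond_pos {Ω : Set Plane} {kI kE : ℝ} (hI : 0 < kI) (hE : 0 < kE) (x : Plane) :
    0 < cond Ω kI kE x := by
  unfold cond; split_ifs <;> assumption

lemma memLp_top_cond {Ω : Set Plane} (hΩ : IsOpen Ω) (kI kE : ℝ) (μ : Measure Plane) :
    MemLp (cond Ω kI kE) ∞ μ := by
  refine memLp_top_of_bound (C := max |kI| |kE|) ?_ (Filter.Eventually.of_forall fun x => ?_)
  · exact (Measurable.ite hΩ.measurableSet measurable_const
      measurable_const).aestronglyMeasurable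
  · unfold cond; split_ifs <;> simp

lemma memLp_top_inv_cond {Ω : Set Plane} (hΩ : IsOpen Ω) (kI kE : ℝ) (μ : Measure Plane) :
    MemLp (fun x => (cond Ω kI kE x)⁻¹) ∞ μ := by
  convert memLp_top_cond hΩ kI⁻¹ kE⁻¹ μ using 2 with x
  unfold cond; split_ifs <;> rfl

variable {k : Plane → ℝ}

lemma integrable_aForm (hD : IsOpen D) (hk : MemLp k ∞ (volume.restrict D)) {u v : Plane → ℝ}
    (hu : MemH1 D u) (hv : MemH1 D v) :
    IntegrableOn (fun x => k x * inner ℝ (weakGrad D u x) (weakGrad D v x) + u x * v x) D := by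
  refine Integrable.add ?_ (hu.1.integrable_mul hv.1)
  have h := integrable_inner_of_memLp ((hu.memLp_weakGrad hD).smul (r := 2) hk)
    (hv.memLp_weakGrad hD)
  simpa [inner_smul_left] using h

lemma aForm_comm (D : Set Plane) (k u v : Plane → ℝ) : aForm D k u v = aForm D k v u := by
  simp only [aForm, real_inner_comm, mul_comm (u _)]

lemma aForm_sub_left (hD : IsOpen D) (hk : MemLp k ∞ (volume.restrict D)) {u₁ u₂ v : Plane → ℝ}
    (h₁ : MemH1 D u₁) (h₂ : MemH1 D u₂) (hv : MemH1 D v) :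
    aForm D k (fun x => u₁ x - u₂ x) v = aForm D k u₁ v - aForm D k u₂ v := by
  rw [aForm, aForm, aForm, ← integral_sub (integrable_aForm hD hk h₁ hv)
    (integrable_aForm hD hk h₂ hv)]
  refine integral_congr_ae ?_
  filter_upwards [weakGrad_sub_ae_eq hD h₁ h₂] with x hx
  rw [hx, inner_sub_left]
  ring

lemma energyNorm_sq (hk : ∀ x, 0 ≤ k x) (v : Plane → ℝ) :
    energyNorm D k v ^ 2 = aForm D k v v :=
  Real.sq_sqrt (integral_nonneg fun x =>
    add_nonneg (mul_nonneg (hk x) real_inner_self_nonneg) (mul_self_nonneg _))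

/-- Young's inequality with weight `c`, from expanding `0 ≤ c⁻¹ |p - c G|²`. -/
lemma two_mul_inner_le {c : ℝ} (hc : 0 < c) (p G : Plane) :
    2 * inner ℝ p G ≤ c⁻¹ * ‖p‖ ^ 2 + c * inner ℝ G G := by
  have h : 0 ≤ c⁻¹ * ‖p - c • G‖ ^ 2 := by positivity
  rw [norm_sub_sq_real, norm_smul, inner_smul_right, Real.norm_of_nonneg hc.le] at h
  rw [real_inner_self_eq_norm_sq]
  have e : c⁻¹ * (‖p‖ ^ 2 - 2 * (c * inner ℝ p G) + (c * ‖G‖) ^ 2)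
      = c⁻¹ * ‖p‖ ^ 2 - 2 * inner ℝ p G + c * ‖G‖ ^ 2 := by
    field_simp
  linarith

/-- If `|||w|||²` is represented by a flux residual `p` and a scalar residual `q`, then it is at
most the weighted square norm of the residuals: Young's inequality bounds the representation by
half that norm plus `½ |||w|||²`, which is absorbed. -/
lemma energyNorm_sq_le_of_residual (hD : IsOpen D) (hk : MemLp k ∞ (volume.restrict D))
    (hk' : MemLp (fun x => (k x)⁻¹) ∞ (volume.restrict D)) (hk0 : ∀ x, 0 < k x)
    {p : Plane → Plane} {q w : Plane → ℝ} (hp : MemLp p 2 (volume.restrict D))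
    (hq : MemLp q 2 (volume.restrict D)) (hw : MemH1 D w)
    (h : aForm D k w w = ∫ x in D, (inner ℝ (p x) (weakGrad D w x) + q x * w x)) :
    energyNorm D k w ^ 2 ≤ ∫ x in D, ((k x)⁻¹ * ‖p x‖ ^ 2 + |q x| ^ 2) := by
  have hG := hw.memLp_weakGrad hD
  have i1 : IntegrableOn (fun x => (k x)⁻¹ * ‖p x‖ ^ 2 + |q x| ^ 2) D := by
    refine Integrable.add ?_ (by simpa using hq.integrable_sq)
    have := integrable_inner_of_memLp (hp.smul (r := 2) hk') hp
    simpa [inner_smul_left, real_inner_self_eq_norm_sq] using this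
  have i2 : IntegrableOn (fun x => inner ℝ (p x) (weakGrad D w x) + q x * w x) D :=
    (integrable_inner_of_memLp hp hG).add (hq.integrable_mul hw.1)
  have i3 := integrable_aForm hD hk hw hw
  have hle : ∫ x in D, 2 * (inner ℝ (p x) (weakGrad D w x) + q x * w x) ≤
      ∫ x in D, (((k x)⁻¹ * ‖p x‖ ^ 2 + |q x| ^ 2) +
        (k x * inner ℝ (weakGrad D w x) (weakGrad D w x) + w x * w x)) := by
    refine integral_mono (i2.const_mul 2) (i1.add i3) fun x => ?_
    have := two_mul_inner_le (hk0 x) (p x) (weakGrad D w x)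
    have h2 := sq_nonneg (q x - w x)
    simp only [sq_abs]
    nlinarith
  rw [integral_const_mul, integral_add i1 i3, ← h] at hle
  rw [energyNorm_sq fun x => (hk0 x).le]
  unfold aForm at hle ⊢
  linarith

/-- The error bound common to the state and the adjoint problems: `a` is the solution, `b` its
approximation, and `c` the value at `w = a - b` of the boundary functional of the flux `σ`, so that
`c + ∫ (P · ∇w + Q w)` is the value at `w` of the load of the variational problem. -/
lemma energyNorm_sq_le_of_flux (hD : IsOpen D) (hk : MemLp k ∞ (volume.restrict D))
    (hk' : MemLp (fun x => (k x)⁻¹) ∞ (volume.restrict D)) (hk0 : ∀ x, 0 < k x)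
    {a b : Plane → ℝ} {P σ : Plane → Plane} {Q : Plane → ℝ} {c : ℝ}
    (ha : MemH1 D a) (hb : MemH1 D b) (hσ : MemHdiv D σ)
    (hP : MemLp P 2 (volume.restrict D)) (hQ : MemLp Q 2 (volume.restrict D))
    (hgreen : ∫ x in D, (inner ℝ (σ x) (weakGrad D (fun x => a x - b x) x) +
      weakDiv D σ x * (a x - b x)) = c)
    (hload : aForm D k a (fun x => a x - b x) = c +
      ∫ x in D, (inner ℝ (P x) (weakGrad D (fun x => a x - b x) x) + Q x * (a x - b x))) :
    energyNorm D k (fun x => a x - b x) ^ 2 ≤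
      ∫ x in D, ((k x)⁻¹ * ‖σ x + P x - k x • weakGrad D b x‖ ^ 2 +
        |weakDiv D σ x + Q x - b x| ^ 2) := by
  have hw : MemH1 D (fun x => a x - b x) := ha.sub hD hb
  have hG := hw.memLp_weakGrad hD
  refine energyNorm_sq_le_of_residual hD hk hk' hk0
    ((hσ.1.add hP).sub ((hb.memLp_weakGrad hD).smul hk))
    (((hσ.memLp_weakDiv hD).add hQ).sub hb.1) hw ?_
  have iP : IntegrableOn (fun x => inner ℝ (P x) (weakGrad D (fun x => a x - b x) x) +
      Q x * (a x - b x)) D :=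
    (integrable_inner_of_memLp hP hG).add (hQ.integrable_mul hw.1)
  have iσ := hσ.integrable_green hD hw
  have iσP : IntegrableOn (fun x => (inner ℝ (σ x) (weakGrad D (fun x => a x - b x) x) +
      weakDiv D σ x * (a x - b x)) + (inner ℝ (P x) (weakGrad D (fun x => a x - b x) x) +
      Q x * (a x - b x))) D := iσ.add iP
  rw [aForm_sub_left hD hk ha hb hw, hload, ← hgreen, ← integral_add iσ iP, aForm,
    ← integral_sub iσP (integrable_aForm hD hk hb hw)]
  refine integral_congr_ae (Filter.Eventually.of_forall fun x => ?_)
  simp only [inner_add_left, inner_sub_left, inner_smul_left, conj_trivial]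
  ring

/-! ### The derivative of the shape functional -/

variable {θ : Plane → Plane}

lemma MemW1inf.memLp_jac (hD : IsOpen D) (hθ : MemW1inf D θ) (i j : Fin 2) :
    MemLp (fun x => jac D θ x i j) ∞ (volume.restrict D) :=
  ((hθ i).memLp_weakGrad hD).eval_piLp j

lemma MemW1inf.memLp_divField (hD : IsOpen D) (hθ : MemW1inf D θ) :
    MemLp (divField D θ) ∞ (volume.restrict D) := by
  have h := (hθ.memLp_jac hD 0 0).add (hθ.memLp_jac hD 1 1)
  refine (memLp_congr_ae (Filter.Eventually.of_forall fun x => ?_)).2 h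
  simp [divField, Matrix.trace_fin_two]

lemma MemW1inf.memLp_Mmat (hD : IsOpen D) (hθ : MemW1inf D θ) (i j : Fin 2) :
    MemLp (fun x => Mmat D θ x i j) ∞ (volume.restrict D) :=
  ((hθ.memLp_jac hD i j).add (hθ.memLp_jac hD j i)).sub
    ((hθ.memLp_divField hD).mul_const ((1 : Matrix (Fin 2) (Fin 2) ℝ) i j))

lemma MemW1inf.memLp_MGrad (hD : IsOpen D) (hθ : MemW1inf D θ) {u : Plane → ℝ}
    (hu : MemH1 D u) : MemLp (MGrad D θ u) 2 (volume.restrict D) := by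
  have hG := hu.memLp_weakGrad hD
  refine MemLp.of_eval_piLp fun i => ?_
  have h := ((hG.eval_piLp 0).mul (r := 2) (hθ.memLp_Mmat hD i 0)).add
    ((hG.eval_piLp 1).mul (r := 2) (hθ.memLp_Mmat hD i 1))
  refine (memLp_congr_ae (Filter.Eventually.of_forall fun x => ?_)).2 h
  simp only [MGrad, Matrix.mulVec, dotProduct, Fin.sum_univ_two, Pi.add_apply, Pi.mul_apply]

lemma Mmat_symm (D : Set Plane) (θ : Plane → Plane) (x : Plane) :
    Mmat D θ x 1 0 = Mmat D θ x 0 1 := by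
  simp [Mmat, add_comm]

/-- Expansion of the integrand of the shape functional along `u + t δ`; the symmetry of `M(θ)`
merges the two cross terms. -/
lemma inner_mulVec_add_smul {M : Matrix (Fin 2) (Fin 2) ℝ} (hM : M 1 0 = M 0 1) (p q : Plane)
    (t : ℝ) :
    inner ℝ (WithLp.toLp 2 (M.mulVec (WithLp.ofLp (p + t • q))) : Plane) (p + t • q) =
      inner ℝ (WithLp.toLp 2 (M.mulVec (WithLp.ofLp p)) : Plane) p +
      2 * t * inner ℝ (WithLp.toLp 2 (M.mulVec (WithLp.ofLp p)) : Plane) q +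
      t ^ 2 * inner ℝ (WithLp.toLp 2 (M.mulVec (WithLp.ofLp q)) : Plane) q := by
  simp [PiLp.inner_apply, Fin.sum_univ_two, hM]
  ring

/-- The directional derivative of the shape functional: along `u + t δ` the functional is a
quadratic polynomial in `t`, and its linear coefficient is read off. -/
lemma HForm_eq (hD : IsOpen D) (hk : MemLp k ∞ (volume.restrict D)) (hθ : MemW1inf D θ)
    {u δ : Plane → ℝ} (hu : MemH1 D u) (hδ : MemH1 D δ) :
    HForm D k θ u δ = ∫ x in D, (inner ℝ (k x • MGrad D θ u x) (weakGrad D δ x) +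
      (-(divField D θ x * u x)) * δ x) := by
  have hpair : ∀ {v w : Plane → ℝ}, MemH1 D v → MemH1 D w →
      IntegrableOn (fun x => inner ℝ (k x • MGrad D θ v x) (weakGrad D w x) +
        (-(divField D θ x * v x)) * w x) D := fun {v w} hv hw =>
    (integrable_inner_of_memLp ((hθ.memLp_MGrad hD hv).smul (r := 2) hk)
      (hw.memLp_weakGrad hD)).add
      (((hv.1.mul (r := 2) (hθ.memLp_divField hD)).neg).integrable_mul hw.1)
  set b : (Plane → ℝ) → (Plane → ℝ) → ℝ := fun v w =>
    ∫ x in D, (inner ℝ (k x • MGrad D θ v x) (weakGrad D w x) +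
      (-(divField D θ x * v x)) * w x) with hb
  have hpoly : ∀ t : ℝ, shapeG D k θ (fun x => u x + t * δ x) =
      (1 / 2) * b u u + t * b u δ + t ^ 2 * ((1 / 2) * b δ δ) := by
    intro t
    have e : ∫ x in D, (k x * inner ℝ (MGrad D θ (fun x => u x + t * δ x) x)
          (weakGrad D (fun x => u x + t * δ x) x) - divField D θ x * (u x + t * δ x) ^ 2)
        = b u u + (2 * t) * b u δ + t ^ 2 * b δ δ := by
      have i1 := (hpair hu hδ).const_mul (2 * t)
      have i2 := (hpair hδ hδ).const_mul (t ^ 2)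
      simp only [hb]
      rw [← integral_const_mul, ← integral_const_mul, ← integral_add (hpair hu hu) i1,
        ← integral_add (by exact (hpair hu hu).add i1) i2]
      refine integral_congr_ae ?_
      filter_upwards [weakGrad_add_mul_ae_eq hD hu hδ t] with x hx
      simp only [MGrad, hx]
      rw [inner_mulVec_add_smul (Mmat_symm D θ x)]
      simp only [inner_smul_left, conj_trivial]
      ring
    rw [shapeG, e]
    ring
  rw [HForm, funext hpoly]
  have hd : HasDerivAt (fun t : ℝ => (1 / 2) * b u u + t * b u δ + t ^ 2 * ((1 / 2) * b δ δ))
      (b u δ) 0 := by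
    have h1 := ((hasDerivAt_id (0 : ℝ)).mul_const (b u δ)).const_add ((1 / 2) * b u u)
    have h2 := (hasDerivAt_pow 2 (0 : ℝ)).mul_const ((1 / 2) * b δ δ)
    simpa [Pi.add_def] using h1.add h2
  exact hd.deriv

/-! ### The error bounds -/

lemma state_bound_of_green
    (hD : IsOpen D) (hk : MemLp k ∞ (volume.restrict D))
    (hk' : MemLp (fun x => (k x)⁻¹) ∞ (volume.restrict D)) (hk0 : ∀ x, 0 < k x)
    {u uh : Plane → ℝ} {σ : Plane → Plane} (hu : MemH1 D u)
    (huh : MemH1 D uh) (hσ : MemHdiv D σ)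
    (h : aForm D k u (fun x => u x - uh x) =
      ∫ x in D, (inner ℝ (σ x) (weakGrad D (fun x => u x - uh x) x) +
        weakDiv D σ x * (u x - uh x))) :
    energyNorm D k (fun x => u x - uh x) ^ 2 ≤ stateBound D k uh σ := by
  have := energyNorm_sq_le_of_flux hD hk hk' hk0 (P := fun _ => 0) (Q := fun _ => 0) hu huh hσ
    MemLp.zero MemLp.zero h.symm (by simp)
  simpa [stateBound] using this

lemma adjoint_bound_of_green
    (hD : IsOpen D) (hk : MemLp k ∞ (volume.restrict D))
    (hk' : MemLp (fun x => (k x)⁻¹) ∞ (volume.restrict D)) (hk0 : ∀ x, 0 < k x)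
    (hθ : MemW1inf D θ) {uh r rh : Plane → ℝ} {ξ : Plane → Plane}
    (huh : MemH1 D uh) (hr : MemH1 D r) (hrh : MemH1 D rh) (hξ : MemHdiv D ξ)
    (h : aForm D k (fun x => r x - rh x) r = HForm D k θ uh (fun x => r x - rh x))
    (hgreen : ∫ x in D, (inner ℝ (ξ x) (weakGrad D (fun x => r x - rh x) x) +
      weakDiv D ξ x * (r x - rh x)) = 0) :
    energyNorm D k (fun x => r x - rh x) ^ 2 ≤ adjBound D k θ uh rh ξ := by
  rw [HForm_eq hD hk hθ huh (hr.sub hD hrh), aForm_comm] at h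
  have := energyNorm_sq_le_of_flux hD hk hk' hk0 hr hrh hξ
    ((hθ.memLp_MGrad hD huh).smul (r := 2) hk)
    (huh.1.mul (r := 2) (hθ.memLp_divField hD)).neg hgreen (h.trans (zero_add _).symm)
  simpa [adjBound, sub_eq_add_neg] using this


end EIT

theorem mainTheorem2 (D Ω : Set EIT.Plane) (hD : EIT.IsBoundedLipschitz D)
    (hΩ : IsOpen Ω) (hΩD : closure Ω ⊆ D) (kI kE : ℝ) (hkI : 0 < kI) (hkE : 0 < kE) :
    (∀ g : EIT.Plane → ℝ, MemLp g 2 (EIT.bdryMeasure D) →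
      ∀ (u uh : EIT.Plane → ℝ) (σ : EIT.Plane → EIT.Plane),
        EIT.IsNeumannState D (EIT.cond Ω kI kE) g u →
        EIT.MemH1 D uh → EIT.MemHdiv D σ → EIT.HasNormalTrace D σ g →
        EIT.energyNorm D (EIT.cond Ω kI kE) (fun x => u x - uh x) ^ 2 ≤
          EIT.stateBound D (EIT.cond Ω kI kE) uh σ) ∧
    (∀ U : EIT.Plane → ℝ, EIT.MemH1 D U →
      ∀ (u uh : EIT.Plane → ℝ) (σ : EIT.Plane → EIT.Plane),
        EIT.IsDirichletState D (EIT.cond Ω kI kE) U u →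
        EIT.MemH1 D uh → EIT.EqOnBdry D uh U → EIT.MemHdiv D σ →
        EIT.energyNorm D (EIT.cond Ω kI kE) (fun x => u x - uh x) ^ 2 ≤
          EIT.stateBound D (EIT.cond Ω kI kE) uh σ) ∧
    (∀ θ : EIT.Plane → EIT.Plane, EIT.MemW1inf D θ →
      ∀ (uh r rh : EIT.Plane → ℝ) (ξ : EIT.Plane → EIT.Plane), EIT.MemH1 D uh →
        EIT.IsNeumannAdjoint D (EIT.cond Ω kI kE) θ uh r →
        EIT.MemH1 D rh → EIT.MemHdiv D ξ → EIT.HasNormalTrace D ξ (fun _ => 0) →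
        EIT.energyNorm D (EIT.cond Ω kI kE) (fun x => r x - rh x) ^ 2 ≤
          EIT.adjBound D (EIT.cond Ω kI kE) θ uh rh ξ) ∧
    (∀ θ : EIT.Plane → EIT.Plane, EIT.MemW1inf D θ →
      ∀ (uh r rh : EIT.Plane → ℝ) (ξ : EIT.Plane → EIT.Plane), EIT.MemH1 D uh →
        EIT.IsDirichletAdjoint D (EIT.cond Ω kI kE) θ uh r →
        EIT.MemH10 D rh → EIT.MemHdiv D ξ →
        EIT.energyNorm D (EIT.cond Ω kI kE) (fun x => r x - rh x) ^ 2 ≤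
          EIT.adjBound D (EIT.cond Ω kI kE) θ uh rh ξ) := by
  have hO := hD.1
  have hk := EIT.memLp_top_cond hΩ kI kE (volume.restrict D)
  have hk' := EIT.memLp_top_inv_cond hΩ kI kE (volume.restrict D)
  have hk0 := EIT.cond_pos (Ω := Ω) hkI hkE
  refine ⟨?_, ?_, ?_, ?_⟩
  · intro g _ u uh σ hu huh hσ hσg
    have hw := hu.1.sub hO huh
    exact EIT.state_bound_of_green hO hk hk' hk0 hu.1 huh hσ
      ((hu.2 _ hw).trans (hσg _ hw).symm)
  · intro U _ u uh σ hu huh huhU hσ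
    have hw : EIT.MemH10 D (fun x => u x - uh x) := by
      simpa using hu.2.1.sub hO huhU
    exact EIT.state_bound_of_green hO hk hk' hk0 hu.1 huh hσ
      ((hu.2.2 _ hw).trans (hσ.green_of_memH10 hO hw).symm)
  · intro θ hθ uh r rh ξ huh hr hrh hξ hξ0
    have hw := hr.1.sub hO hrh
    exact EIT.adjoint_bound_of_green hO hk hk' hk0 hθ huh hr.1 hrh hξ (hr.2 _ hw)
      (by simpa using hξ0 _ hw)
  · intro θ hθ uh r rh ξ huh hr hrh hξ
    have hw := hr.1.sub hO hrh
    exact EIT.adjoint_bound_of_green hO hk hk' hk0 hθ huh hr.1.1 hrh.1 hξ (hr.2 _ hw)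
      (hξ.green_of_memH10 hO hw)
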